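/- Let $n\ge 1$, $N=2^n$, and let $\mathcal H=\mathbb C^n\otimes\mathbb C^{2^n}$ have the orthonormal basis $|d,\vec x\rangle$, where $d\in\{1,\dots,n\}$ is a direction (the coin) and $\vec x\in\{0,1\}^n$ is a node of the $n$-cube. Let $S|d,\vec x\rangle=|d,\vec x\oplus\vec e_d\rangle$, let $|s\rangle=\frac1{\sqrt n}\sum_d|d\rangle$ and let $G=-I+2|s\rangle\langle s|$. Let $f:\{0,1\}^n\to\{0,1\}$ take the value $1$ at exactly one node $\vec w$, the marked node. The coin oracle $C'$ of $f$ applies $-I$ to the coin register at the marked node and $G$ to the coin register at every other node. Put $U'=S\cdot C'$ and $|\psi_0\rangle=\frac1{\sqrt{n2^n}}\sum_{d,\vec x}|d,\vec x\rangle$, and let $t_f=\frac{\pi}{2}\sqrt{2^{n-1}}$. (1) There are constants $C,K>0$ and $k\ge 1$ such that for all $n\ge k$, all such $f$, and every non-negative integer $t$ with $|t-t_f|\le 1$ (in particular for the integer closest to $t_f$), the probability $p=\sum_d|\langle d,\vec w|(U')^t|\psi_0\rangle|^2$ that a measurement of $(U')^t|\psi_0\rangle$ in the basis $|d,\vec x\rangle$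 gives the marked node satisfies $$0\le \tfrac12-p\le \frac Cn,$$ that is, $p=\frac12-O(1/n)$. The state $(U')^t|\psi_0\rangle$ is produced from $|\psi_0\rangle$ by the program that $t$ times calls the coin oracle $C'$ and then applies the fixed gate $S$; this program does not depend on $f$, and makes at most $K\sqrt N$ oracle calls. (2) Consequently search takes $O(\sqrt N)$ oracle calls: for every $\varepsilon>0$ there are a number of repetitions $r$ and constants $K>0$ and $k\ge 1$, depending only on $\varepsilon$, such that for all $n\ge k$, all such $f$, and every non-negative integer $t$ with $|t-t_f|\le 1$, the following procedure outputs $\vec w$ with probability at least $1-\varepsilon$: perform $r$ independent runs of the program in (1) from $|\psi_0\rangle$, each followed by a measurement in the basis $|d,\vec x\rangle$, evaluate $f$ at the $r$ observed nodes, and output the first observed node at which $f$ is $1$. Its total number of oracle calls, $rt$ calls to $C'$ and $r$ evaluations of $f$, is at most $K\sqrt N$. -/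

import Mathlib

open scoped Matrix

noncomputable section

namespace HypercubeSearch

/-- Nodes of the `n`-cube: `n`-bit strings, with bitwise addition modulo 2. -/
abbrev Node (n : ℕ) : Type := Fin n → ZMod 2

/-- Labels `(d, x)` of the computational basis states `|d, x⟩` of `ℂⁿ ⊗ ℂ^(2^n)`. -/
abbrev Label (n : ℕ) : Type := Fin n × Node n

/-- State vectors, given by their amplitudes in the basis `|d, x⟩`. -/
abbrev State (n : ℕ) : Type := Label n → ℂ

abbrev Operator (n : ℕ) : Type := Matrix (Label n) (Label n) ℂ

/-- The equal superposition over the `n` directions. -/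
def coinState (n : ℕ) : Fin n → ℂ := fun _ => ((1 / √(n : ℝ) : ℝ) : ℂ)

/-- The equal superposition over the `2^n` nodes. -/
def nodeState (n : ℕ) : Node n → ℂ := fun _ => ((1 / √((2 : ℝ) ^ n) : ℝ) : ℂ)

/-- The initial state, the tensor product of the two equal superpositions. -/
def initialState (n : ℕ) : State n := fun b => coinState n b.1 * nodeState n b.2

/-- The Grover diffusion coin `G = -I + 2 |s⟩⟨s|`, with `s` the equal superposition. -/
def grover (n : ℕ) : Matrix (Fin n) (Fin n) ℂ :=
  -1 + (2 : ℂ) • Matrix.vecMulVec (coinState n) (star (coinState n))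

/-- The coin oracle `C'` of `f`: it applies to the coin register the coin `-I` at the nodes `x`
with `f x = true`, and the coin `G` at all other nodes. -/
def coinOracle {n : ℕ} (f : Node n → Bool) : Operator n :=
  Matrix.blockDiagonal fun x => if f x = true then -1 else grover n

/-- The neighbour of a basis label: `(d, x) ↦ (d, x ⊕ e_d)`. -/
def move {n : ℕ} (b : Label n) : Label n := (b.1, b.2 + Pi.single b.1 1)

/-- The shift `S = ∑ |d, x ⊕ e_d⟩⟨d, x|`. -/
def shift (n : ℕ) : Operator n := Matrix.of fun b b' => if b = move b' then 1 else 0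

/-- The perturbed walk operator `U' = S · C'`. -/
def walk {n : ℕ} (f : Node n → Bool) : Operator n := shift n * coinOracle f

/-- Born rule: probability of the outcome `b` in a measurement in the basis `|d, x⟩`. -/
def outcomeProb {n : ℕ} (ψ : State n) (b : Label n) : ℝ := ‖ψ b‖ ^ 2

/-- Probability that a measurement in the basis `|d, x⟩` finds the walker at the node `x`. -/
def nodeProb {n : ℕ} (ψ : State n) (x : Node n) : ℝ := ∑ d : Fin n, outcomeProb ψ (d, x)

theorem move_move {n : ℕ} (b : Label n) : move (move b) = b := by
  refine Prod.ext rfl ?_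
  show b.2 + Pi.single b.1 1 + Pi.single b.1 1 = b.2
  funext i
  simp [add_assoc, CharTwo.add_self_eq_zero]

theorem shift_mem_unitaryGroup (n : ℕ) : shift n ∈ Matrix.unitaryGroup (Label n) ℂ := by
  have hstar : star (shift n) = shift n := by
    ext b b'
    have h : b' = move b ↔ b = move b' :=
      ⟨fun h => by rw [h, move_move], fun h => by rw [h, move_move]⟩
    simp only [shift, Matrix.star_apply, Matrix.of_apply, h]
    split_ifs <;> simp
  rw [Matrix.mem_unitaryGroup_iff, hstar]
  ext b b'
  have h : b = move (move b') ↔ b = b' := by rw [move_move]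
  simp only [shift, Matrix.mul_apply, Matrix.of_apply, mul_ite, mul_one, mul_zero,
    Finset.sum_ite_eq', Finset.mem_univ, if_true, h, Matrix.one_apply]

/-- One instruction of a quantum oracle algorithm on the register `|d, x⟩`: a fixed unitary gate
(independent of the oracle), or one call to the coin oracle. -/
inductive Instr (n : ℕ) : Type where
  | gate (V : Matrix.unitaryGroup (Label n) ℂ) : Instr n
  | oracle : Instr n

/-- The operator that an instruction performs when the oracle is that of `f`. -/
def Instr.op {n : ℕ} (f : Node n → Bool) : Instr n → Operator n
  | .gate V => V
  | .oracle => coinOracle f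

/-- The number of oracle calls of an instruction. -/
def Instr.cost {n : ℕ} : Instr n → ℕ
  | .gate _ => 0
  | .oracle => 1

/-- Final state of a program (a list of instructions, the first to be executed first). -/
def run {n : ℕ} (f : Node n → Bool) (A : List (Instr n)) (ψ : State n) : State n :=
  A.foldl (fun φ s => s.op f *ᵥ φ) ψ

/-- Number of oracle calls of a program. -/
def oracleCalls {n : ℕ} (A : List (Instr n)) : ℕ := (A.map Instr.cost).sum

/-- The walk search program: `t` times, call the coin oracle and then shift. It does not depend
on the marked node. -/
def walkSearch (n t : ℕ) : List (Instr n) :=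
  (List.replicate t [Instr.oracle, Instr.gate ⟨shift n, shift_mem_unitaryGroup n⟩]).flatten

/-- The walk search program applies `U' ^ t`. -/
theorem run_walkSearch {n : ℕ} (f : Node n → Bool) (t : ℕ) (ψ : State n) :
    run f (walkSearch n t) ψ = walk f ^ t *ᵥ ψ := by
  induction t generalizing ψ with
  | zero => simp [run, walkSearch]
  | succ t ih =>
    have h : run f (walkSearch n (t + 1)) ψ =
        run f (walkSearch n t) (shift n *ᵥ (coinOracle f *ᵥ ψ)) := by
      simp [run, walkSearch, List.replicate_succ, Instr.op]
    rw [h, ih, pow_succ, Matrix.mulVec_mulVec, Matrix.mulVec_mulVec, walk, Matrix.mul_assoc]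

/-- Classical post-processing of the measurement outcomes of `r` runs: evaluate `f` at the
observed nodes, one after the other, and return the first one with `f x = true`, if any.
This takes at most `r` evaluations of `f`. -/
def searchOutput {n r : ℕ} (f : Node n → Bool) (o : Fin r → Label n) : Option (Node n) :=
  (List.ofFn fun i => (o i).2).find? f

/-- Probability that `r` independent runs of the program `A` from the initial state, each
followed by a measurement in the basis `|d, x⟩`, lead to the output `w`. -/
def repeatedProb {n : ℕ} (f : Node n → Bool) (A : List (Instr n)) (r : ℕ) (w : Node n) : ℝ :=
  ∑ o : Fin r → Label n with searchOutput f o = some w,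
    ∏ i, outcomeProb (run f A (initialState n)) (o i)

/-- Oracle calls of `r` runs of `A` with post-processing: the calls to the coin oracle, and one
evaluation of `f` for each of the `r` observed nodes. -/
def repeatedCalls {n : ℕ} (A : List (Instr n)) (r : ℕ) : ℕ := r * oracleCalls A + r

/-- The (real) number of steps `(π / 2) √(2 ^ (n - 1))`, for `n ≥ 1`. -/
def finalTime (n : ℕ) : ℝ := Real.pi / 2 * √((2 : ℝ) ^ (n - 1))

end HypercubeSearch

end

noncomputable section

namespace HypercubeSearch

/-! Write N = 2 ^ n. The idea is to find a plane near the initial state on which the perturbed walk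
is exactly a rotation. If g vanishes at w and its neighbour average is cos θ times g away from w,
then `lift g` and its shift span an invariant space on which the walk satisfies z ^ 2 - 2 z cos θ +
1 = 0; this gives the closed form `walk_pow_mulVec_lift`.

Such a g is the Green function of the cube with pole w at energy 1 - δ, once δ solves the secular
equation N δ h = 1 with h = `greenTail n δ`, which says g w = 0 (`exists_secular_root`). Its
constant Fourier mode is -h, and the spectral gap 2 / n makes the other modes small, so -g / (h √N),
lifted, is within √(n / N) of the initial state. Unitarity preserves this distance for all t. By
symmetry g = -1 at every neighbour of w, so the rotated state has probability sin² (t θ) / ((2 - δ)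
h) at w (`abs_sqrt_nodeProb_walk_sub_le`).

Moments of the cube's spectrum give h = 1 + Θ(1 / n) (`greenTail_lower`, `greenTail_upper`). Hence θ
≈ √(2 / N), t θ is within O(1 / n) of π / 2 near the final time, and the probability is 1 / 2 - Θ(1
/ n). That h exceeds 1 by about 1 / n at least is what keeps the probability below 1 / 2. Repetition
then amplifies the success probability. -/

/-! ### Unitarity and the operators in coordinates. -/

theorem sum_outcomeProb_mulVec {n : ℕ} {M : Operator n}
    (hM : M ∈ Matrix.unitaryGroup (Label n) ℂ) (ψ : State n) :
    ∑ b, outcomeProb (M *ᵥ ψ) b = ∑ b, outcomeProb ψ b := by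
  have key : ∀ φ : State n, ((∑ b, outcomeProb φ b : ℝ) : ℂ) = star φ ⬝ᵥ φ := by
    intro φ
    simp only [outcomeProb, dotProduct, Complex.ofReal_sum, Pi.star_apply]
    refine Finset.sum_congr rfl fun b _ => ?_
    rw [Complex.ofReal_pow, ← Complex.conj_mul']
    rfl
  have h : ((∑ b, outcomeProb (M *ᵥ ψ) b : ℝ) : ℂ) = ((∑ b, outcomeProb ψ b : ℝ) : ℂ) := by
    rw [key, key, Matrix.star_mulVec, ← Matrix.dotProduct_mulVec, Matrix.mulVec_mulVec]
    have h1 : Mᴴ * M = 1 := Matrix.mem_unitaryGroup_iff'.1 hM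
    rw [h1, Matrix.one_mulVec]
  exact_mod_cast h

theorem coinState_mul_self {n : ℕ} (d d' : Fin n) :
    coinState n d * coinState n d' = ((1 / n : ℝ) : ℂ) := by
  have h : (1 / √(n : ℝ)) * (1 / √(n : ℝ)) = 1 / n := by
    rw [div_mul_div_comm, Real.mul_self_sqrt (Nat.cast_nonneg n), one_mul]
  simp only [coinState]
  rw [← Complex.ofReal_mul, h]

theorem star_coinState (n : ℕ) : star (coinState n) = coinState n := by
  funext d
  simp [coinState]

theorem norm_coinState_sq {n : ℕ} (d : Fin n) : ‖coinState n d‖ ^ 2 = 1 / n := by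
  simp [coinState]

theorem coinState_dotProduct_self {n : ℕ} (hn : 1 ≤ n) : coinState n ⬝ᵥ coinState n = 1 := by
  have h0 : (n : ℂ) ≠ 0 := by exact_mod_cast (by omega : n ≠ 0)
  simp only [dotProduct, coinState_mul_self]
  simp [h0]

theorem grover_conjTranspose (n : ℕ) : (grover n)ᴴ = grover n := by
  simp [grover, Matrix.conjTranspose_add, Matrix.conjTranspose_smul,
    Matrix.conjTranspose_vecMulVec, star_coinState]

theorem grover_mul_self {n : ℕ} (hn : 1 ≤ n) : grover n * grover n = 1 := by
  have h : Matrix.vecMulVec (coinState n) (coinState n) *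
      Matrix.vecMulVec (coinState n) (coinState n) =
      Matrix.vecMulVec (coinState n) (coinState n) := by
    rw [Matrix.vecMulVec_mul_vecMulVec, coinState_dotProduct_self hn]
    simp
  simp only [grover, star_coinState, add_mul, mul_add, smul_mul_assoc, mul_smul_comm, h]
  simp only [neg_mul, mul_neg, one_mul, mul_one, neg_neg]
  module

theorem coinOracle_mem_unitaryGroup {n : ℕ} (hn : 1 ≤ n) (f : Node n → Bool) :
    coinOracle f ∈ Matrix.unitaryGroup (Label n) ℂ := by
  rw [Matrix.mem_unitaryGroup_iff', Matrix.star_eq_conjTranspose, coinOracle,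
    Matrix.blockDiagonal_conjTranspose, ← Matrix.blockDiagonal_mul, ← Matrix.blockDiagonal_one]
  congr 1
  funext x
  by_cases h : f x = true
  · simp [h]
  · simp [h, grover_conjTranspose, grover_mul_self hn]

theorem walk_pow_mem_unitaryGroup {n : ℕ} (hn : 1 ≤ n) (f : Node n → Bool) (t : ℕ) :
    walk f ^ t ∈ Matrix.unitaryGroup (Label n) ℂ :=
  pow_mem (mul_mem (shift_mem_unitaryGroup n) (coinOracle_mem_unitaryGroup hn f)) t

theorem card_node (n : ℕ) : Fintype.card (Node n) = 2 ^ n := by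
  simp [Node, ZMod.card]

theorem sum_outcomeProb_initialState {n : ℕ} (hn : 1 ≤ n) :
    ∑ b, outcomeProb (initialState n) b = 1 := by
  have h0 : (n : ℝ) ≠ 0 := by exact_mod_cast (by omega : n ≠ 0)
  have hx : ∀ x, ‖nodeState n x‖ ^ 2 = 1 / 2 ^ n := by
    intro x
    rw [nodeState, Complex.norm_real, Real.norm_eq_abs, sq_abs, div_pow, one_pow,
      Real.sq_sqrt (by positivity)]
  simp only [outcomeProb, initialState, norm_mul, mul_pow, norm_coinState_sq, hx,
    Finset.sum_const, Finset.card_univ, Fintype.card_prod, Fintype.card_fin, card_node]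
  rw [nsmul_eq_mul]
  push_cast
  field_simp

theorem shift_mulVec_apply {n : ℕ} (ψ : State n) (b : Label n) :
    (shift n *ᵥ ψ) b = ψ (move b) := by
  have h : ∀ b', b = move b' ↔ b' = move b :=
    fun b' => ⟨fun h => by rw [h, move_move], fun h => by rw [h, move_move]⟩
  simp [Matrix.mulVec, dotProduct, shift, h]

theorem coinOracle_mulVec_apply {n : ℕ} (f : Node n → Bool) (ψ : State n)
    (d : Fin n) (x : Node n) :
    (coinOracle f *ᵥ ψ) (d, x) =
      if f x = true then -ψ (d, x) else -ψ (d, x) + 2 * ((1 / n : ℝ) : ℂ) * ∑ d', ψ (d', x) := by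
  have h : (coinOracle f *ᵥ ψ) (d, x) =
      ∑ d', (if f x = true then -1 else grover n : Matrix (Fin n) (Fin n) ℂ) d d' * ψ (d', x) := by
    simp only [Matrix.mulVec, dotProduct, Fintype.sum_prod_type, coinOracle,
      Matrix.blockDiagonal_apply, ite_mul, zero_mul, Finset.sum_ite_eq, Finset.mem_univ, if_true]
  rw [h]
  split_ifs with hf
  · simp [Matrix.one_apply]
  · simp only [grover, star_coinState, Matrix.add_apply, Matrix.neg_apply, Matrix.smul_apply,
      Matrix.vecMulVec_apply, coinState_mul_self, add_mul, Finset.sum_add_distrib,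
      Finset.mul_sum]
    simp [Matrix.one_apply]

/-! ### The invariant plane of the perturbed walk. -/

/-- The state with uniform coin and node amplitudes `g`. -/
def lift {n : ℕ} (g : Node n → ℝ) : State n := fun b => coinState n b.1 * (g b.2 : ℂ)

/-- The Grover coin fixes the uniform coin state, and the sign at `w` acts on a zero amplitude, so
the oracle acts trivially. -/
theorem walk_mulVec_lift {n : ℕ} (hn : 1 ≤ n) {f : Node n → Bool} {w : Node n}
    (hf : ∀ x, f x = true ↔ x = w) {g : Node n → ℝ} (hg : g w = 0) :
    walk f *ᵥ lift g = shift n *ᵥ lift g := by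
  have h0 : (n : ℂ) ≠ 0 := by exact_mod_cast (by omega : n ≠ 0)
  rw [walk, ← Matrix.mulVec_mulVec]
  congr 1
  funext ⟨d, x⟩
  rw [coinOracle_mulVec_apply]
  split_ifs with h
  · rw [(hf x).1 h]
    simp [lift, hg]
  · simp only [lift, coinState, Finset.sum_const, Finset.card_univ, Fintype.card_fin]
    push_cast
    simp only [nsmul_eq_mul]
    field_simp
    ring

/-- Off `w`, the Grover coin reflects the neighbour values about their mean `y * g x`. At `w` no
averaging is needed: the coin `-I` yields the same formula because `lift g` vanishes there. -/
theorem walk_mulVec_shift_lift {n : ℕ} (hn : 1 ≤ n) {f : Node n → Bool} {w : Node n}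
    (hf : ∀ x, f x = true ↔ x = w) {g : Node n → ℝ} {y : ℝ} (hg : g w = 0)
    (hy : ∀ x, x ≠ w → ∑ d, g (x + Pi.single d 1) = n * (y * g x)) :
    walk f *ᵥ (shift n *ᵥ lift g) = ((2 * y : ℝ) : ℂ) • (shift n *ᵥ lift g) - lift g := by
  have h0 : (n : ℂ) ≠ 0 := by exact_mod_cast (by omega : n ≠ 0)
  have h : coinOracle f *ᵥ (shift n *ᵥ lift g) =
      ((2 * y : ℝ) : ℂ) • lift g - shift n *ᵥ lift g := by
    funext ⟨d, x⟩
    rw [coinOracle_mulVec_apply]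
    simp only [Pi.sub_apply, Pi.smul_apply, shift_mulVec_apply, smul_eq_mul]
    split_ifs with h
    · rw [(hf x).1 h]
      simp [lift, hg]
    · have h1 : ∑ d', lift g (move (d', x)) =
          coinState n d * ((∑ d', g (x + Pi.single d' 1) : ℝ) : ℂ) := by
        simp [lift, move, coinState, Finset.mul_sum]
      rw [h1, hy x (fun e => h ((hf x).2 e))]
      simp only [lift]
      push_cast
      field_simp
      ring
  rw [walk, ← Matrix.mulVec_mulVec, h, Matrix.mulVec_sub, Matrix.mulVec_smul]
  congr 1
  funext b
  rw [shift_mulVec_apply, shift_mulVec_apply, move_move]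

/-- The two preceding identities give the Chebyshev recursion, solved by sines. The factor `sin θ`
stays on the left, so it may vanish here. -/
theorem walk_pow_mulVec_lift {n : ℕ} (hn : 1 ≤ n) {f : Node n → Bool} {w : Node n}
    (hf : ∀ x, f x = true ↔ x = w) {g : Node n → ℝ} {θ : ℝ} (hg : g w = 0)
    (hy : ∀ x, x ≠ w → ∑ d, g (x + Pi.single d 1) = n * (Real.cos θ * g x)) (t : ℕ) :
    ((Real.sin θ : ℝ) : ℂ) • (walk f ^ t *ᵥ lift g) =
      ((Real.sin (t * θ) : ℝ) : ℂ) • (shift n *ᵥ lift g)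
        - ((Real.sin (t * θ - θ) : ℝ) : ℂ) • lift g := by
  induction t with
  | zero => simp
  | succ t ih =>
    rw [pow_succ', ← Matrix.mulVec_mulVec, ← Matrix.mulVec_smul, ih, Matrix.mulVec_sub,
      Matrix.mulVec_smul, Matrix.mulVec_smul, walk_mulVec_lift hn hf hg,
      walk_mulVec_shift_lift hn hf hg hy]
    have h1 : ((t + 1 : ℕ) : ℝ) * θ = t * θ + θ := by push_cast; ring
    rw [h1, add_sub_cancel_right, Real.sin_add, Real.sin_sub]
    push_cast
    module

/-! ### Fourier analysis on the cube. -/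

/-- The character `a ↦ (-1) ^ a` of `ZMod 2`. -/
def bitSign (a : ZMod 2) : ℝ := if a = 0 then 1 else -1

theorem bitSign_zero : bitSign 0 = 1 := by simp [bitSign]

theorem bitSign_add (a b : ZMod 2) : bitSign (a + b) = bitSign a * bitSign b := by
  have h : ∀ a b : ZMod 2, (a + b = 0 ↔ (a = 0 ↔ b = 0)) := by decide
  simp only [bitSign, h]
  by_cases ha : a = 0 <;> by_cases hb : b = 0 <;> simp [ha, hb]

/-- The characters of the cube. -/
def cubeChar {n : ℕ} (k x : Node n) : ℝ := ∏ i, bitSign (k i * x i)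

theorem cubeChar_comm {n : ℕ} (k x : Node n) : cubeChar k x = cubeChar x k := by
  simp only [cubeChar, mul_comm]

theorem cubeChar_add {n : ℕ} (k x y : Node n) :
    cubeChar k (x + y) = cubeChar k x * cubeChar k y := by
  simp only [cubeChar, Pi.add_apply, mul_add, bitSign_add, Finset.prod_mul_distrib]

theorem cubeChar_zero_left {n : ℕ} (x : Node n) : cubeChar 0 x = 1 := by
  simp [cubeChar, bitSign_zero]

theorem cubeChar_zero_right {n : ℕ} (k : Node n) : cubeChar k 0 = 1 := by
  simp [cubeChar, bitSign_zero]

theorem cubeChar_single {n : ℕ} (k : Node n) (d : Fin n) :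
    cubeChar k (Pi.single d 1) = bitSign (k d) := by
  rw [cubeChar, Finset.prod_eq_single d]
  · simp
  · intro i _ hi
    simp [Pi.single_eq_of_ne hi, bitSign_zero]
  · simp

theorem node_add_self {n : ℕ} (x : Node n) : x + x = 0 := by
  funext i
  exact CharTwo.add_self_eq_zero (x i)

theorem sum_cubeChar {n : ℕ} (x : Node n) :
    ∑ k, cubeChar k x = if x = 0 then (2 : ℝ) ^ n else 0 := by
  have h1 : ∀ b : ZMod 2, ∑ a : ZMod 2, bitSign (a * b) = if b = 0 then 2 else 0 := by
    intro b
    have hu : (Finset.univ : Finset (ZMod 2)) = {0, 1} := by decide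
    have hb : b = 0 ∨ b = 1 := by revert b; decide
    rw [hu, Finset.sum_pair (by decide)]
    rcases hb with rfl | rfl <;> norm_num [bitSign]
  have h2 : ∑ k, cubeChar k x = ∏ i, ∑ a : ZMod 2, bitSign (a * x i) := by
    rw [Finset.prod_univ_sum, Fintype.piFinset_univ]
    rfl
  rw [h2]
  simp only [h1]
  split_ifs with h
  · simp [h]
  · obtain ⟨i, hi⟩ := Function.ne_iff.1 h
    exact Finset.prod_eq_zero (Finset.mem_univ i) (if_neg hi)

/-- Parseval's identity. -/
theorem sum_sq_sum_mul_cubeChar {n : ℕ} (a : Node n → ℝ) :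
    ∑ x, (∑ k, a k * cubeChar k x) ^ 2 = 2 ^ n * ∑ k, a k ^ 2 := by
  have h1 : ∀ k l : Node n, ∑ x, cubeChar k x * cubeChar l x = if l = k then (2 : ℝ) ^ n else 0 := by
    intro k l
    have h2 : ∀ x, cubeChar k x * cubeChar l x = cubeChar x (k + l) := by
      intro x
      rw [cubeChar_add, cubeChar_comm k, cubeChar_comm l]
    have h3 : k + l = 0 ↔ l = k := by
      constructor
      · intro h
        have : k + (k + l) = k := by rw [h, add_zero]
        rwa [← add_assoc, node_add_self, zero_add] at this
      · rintro rfl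
        exact node_add_self l
    simp only [h2, sum_cubeChar, h3]
  calc ∑ x, (∑ k, a k * cubeChar k x) ^ 2
      = ∑ x, ∑ k, ∑ l, a k * a l * (cubeChar k x * cubeChar l x) := by
        refine Finset.sum_congr rfl fun x _ => ?_
        rw [sq, Finset.sum_mul_sum]
        refine Finset.sum_congr rfl fun k _ => Finset.sum_congr rfl fun l _ => by ring
    _ = ∑ k, ∑ l, a k * a l * ∑ x, cubeChar k x * cubeChar l x := by
        rw [Finset.sum_comm]
        refine Finset.sum_congr rfl fun k _ => ?_
        rw [Finset.sum_comm]
        refine Finset.sum_congr rfl fun l _ => by rw [Finset.mul_sum]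
    _ = 2 ^ n * ∑ k, a k ^ 2 := by
        simp only [h1, mul_ite, mul_zero, Finset.sum_ite_eq', Finset.mem_univ, if_true,
          Finset.mul_sum]
        refine Finset.sum_congr rfl fun k _ => by ring

/-! ### The Green function. -/

/-- The eigenvalue of the adjacency matrix of the cube at the character of `k`. -/
def signSum {n : ℕ} (k : Node n) : ℝ := ∑ i, bitSign (k i)

/-- The Green function of the simple random walk on the cube, with pole `w`. -/
def green {n : ℕ} (y : ℝ) (w x : Node n) : ℝ :=
  ∑ k, (1 / (2 ^ n * (y - signSum k / n))) * cubeChar k (x + w)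

theorem green_self {n : ℕ} (y : ℝ) (w : Node n) :
    green y w w = ∑ k : Node n, 1 / (2 ^ n * (y - signSum k / n)) := by
  simp only [green, node_add_self, cubeChar_zero_right, mul_one]

/-- Characters diagonalize the adjacency matrix, and the point mass at `w` has constant Fourier
coefficients up to translation. -/
theorem sum_green_neighbours {n : ℕ} (hn : 1 ≤ n) {y : ℝ}
    (hy : ∀ k : Node n, y - signSum k / n ≠ 0) (w x : Node n) :
    ∑ d, green y w (x + Pi.single d 1) = n * (y * green y w x - if x = w then 1 else 0) := by
  have h0 : (n : ℝ) ≠ 0 := by exact_mod_cast (by omega : n ≠ 0)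
  have hxw : x + w = 0 ↔ x = w := by
    constructor
    · intro h
      have : x + (w + w) = w := by rw [← add_assoc, h, zero_add]
      rwa [node_add_self, add_zero] at this
    · rintro rfl
      exact node_add_self x
  have h1 : (if x = w then (1 : ℝ) else 0) = ∑ k : Node n, 1 / 2 ^ n * cubeChar k (x + w) := by
    rw [← Finset.mul_sum, sum_cubeChar]
    simp only [hxw]
    split_ifs <;> simp
  rw [h1]
  simp only [green]
  rw [Finset.sum_comm, Finset.mul_sum, ← Finset.sum_sub_distrib, Finset.mul_sum]
  refine Finset.sum_congr rfl fun k _ => ?_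
  have h2 : ∀ d : Fin n, cubeChar k (x + Pi.single d 1 + w) = cubeChar k (x + w) * bitSign (k d) := by
    intro d
    rw [add_right_comm, cubeChar_add, cubeChar_single]
  simp only [h2, ← Finset.mul_sum]
  change _ * (_ * signSum k) = _
  have h3 : signSum k = n * (y - (y - signSum k / n)) := by field_simp; ring
  have h4 := hy k
  generalize y - signSum k / n = D at h3 h4 ⊢
  rw [h3]
  field_simp

/-- Swapping two coordinates of the frequency `k` preserves its eigenvalue. -/
theorem green_neighbour_eq {n : ℕ} (y : ℝ) (w : Node n) (d d' : Fin n) :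
    green y w (w + Pi.single d 1) = green y w (w + Pi.single d' 1) := by
  have h : ∀ e : Fin n, green y w (w + Pi.single e 1) =
      ∑ k : Node n, (1 / (2 ^ n * (y - signSum k / n))) * bitSign (k e) := by
    intro e
    simp only [green]
    refine Finset.sum_congr rfl fun k _ => ?_
    rw [add_right_comm, node_add_self, zero_add, cubeChar_single]
  rw [h, h, ← Equiv.sum_comp (Equiv.arrowCongr (Equiv.swap d d') (Equiv.refl (ZMod 2)))]
  refine Finset.sum_congr rfl fun k _ => ?_
  have hs : signSum ((Equiv.arrowCongr (Equiv.swap d d') (Equiv.refl (ZMod 2))) k) = signSum k := by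
    simp only [signSum, Equiv.arrowCongr_apply, Function.comp, Equiv.refl_apply]
    exact Equiv.sum_comp (Equiv.swap d d').symm fun i => bitSign (k i)
  rw [hs]
  simp [Equiv.arrowCongr_apply]

/-- At the pole only the source term survives, so the neighbour values sum to `-n`; by symmetry they
are equal. -/
theorem green_neighbour {n : ℕ} (hn : 1 ≤ n) {y : ℝ}
    (hy : ∀ k : Node n, y - signSum k / n ≠ 0) {w : Node n} (hw : green y w w = 0) (d : Fin n) :
    green y w (w + Pi.single d 1) = -1 := by
  have h0 : (n : ℝ) ≠ 0 := by exact_mod_cast (by omega : n ≠ 0)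
  have h := sum_green_neighbours hn hy w w
  rw [hw, Finset.sum_congr rfl fun e _ => green_neighbour_eq y w e d] at h
  simp only [Finset.sum_const, Finset.card_univ, Fintype.card_fin, nsmul_eq_mul, if_true,
    mul_zero, zero_sub] at h
  exact mul_left_cancel₀ h0 h

theorem signSum_zero (n : ℕ) : signSum (0 : Node n) = n := by
  simp [signSum, bitSign_zero]

/-- The subtracted constant is the mode `k = 0`; Parseval applies to the rest. -/
theorem sum_sq_green_sub_mean {n : ℕ} (hn : 1 ≤ n) (y : ℝ) (w : Node n) :
    ∑ x, (green y w x - 1 / (2 ^ n * (y - 1))) ^ 2 =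
      2 ^ n * ∑ k ∈ Finset.univ.erase (0 : Node n), (1 / (2 ^ n * (y - signSum k / n))) ^ 2 := by
  have h0 : (n : ℝ) ≠ 0 := by exact_mod_cast (by omega : n ≠ 0)
  set a : Node n → ℝ := fun k => if k = 0 then 0 else 1 / (2 ^ n * (y - signSum k / n)) with ha
  have h1 : ∀ x, green y w x - 1 / (2 ^ n * (y - 1)) = ∑ k, a k * cubeChar k (x + w) := by
    intro x
    rw [green, ← Finset.add_sum_erase _ _ (Finset.mem_univ (0 : Node n)),
      ← Finset.add_sum_erase _ (fun k => a k * cubeChar k (x + w)) (Finset.mem_univ (0 : Node n)),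
      cubeChar_zero_left, signSum_zero, div_self h0]
    have : ∑ k ∈ Finset.univ.erase (0 : Node n), a k * cubeChar k (x + w) =
        ∑ k ∈ Finset.univ.erase (0 : Node n),
          (1 / (2 ^ n * (y - signSum k / n))) * cubeChar k (x + w) :=
      Finset.sum_congr rfl fun k hk => by rw [ha]; simp only [if_neg (Finset.ne_of_mem_erase hk)]
    rw [this, ha]
    simp
  simp only [h1]
  have h2 : ∑ x, (∑ k, a k * cubeChar k (x + w)) ^ 2 = ∑ x, (∑ k, a k * cubeChar k x) ^ 2 :=
    Equiv.sum_comp (Equiv.addRight w) fun x => (∑ k, a k * cubeChar k x) ^ 2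
  rw [h2, sum_sq_sum_mul_cubeChar, ← Finset.add_sum_erase _ _ (Finset.mem_univ (0 : Node n))]
  congr 1
  have : a 0 = 0 := by simp [ha]
  rw [this, zero_pow two_ne_zero, zero_add]
  exact Finset.sum_congr rfl fun k hk => by rw [ha]; simp only [if_neg (Finset.ne_of_mem_erase hk)]

/-! ### Moments of the spectrum and the spectral gap. -/

/-- Condition on the first bit: under uniform `k`, `signSum k` is a sum of independent fair signs.
-/
theorem sum_signSum_succ (n : ℕ) (φ : ℝ → ℝ) :
    ∑ k : Node (n + 1), φ (signSum k) =
      ∑ k : Node n, (φ (signSum k + 1) + φ (signSum k - 1)) := by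
  have hu : (Finset.univ : Finset (ZMod 2)) = {0, 1} := by decide
  have h : ∀ (a : ZMod 2) (k : Node n),
      signSum (Fin.consEquiv (fun _ => ZMod 2) (a, k) : Node (n + 1)) = bitSign a + signSum k := by
    intro a k
    simp [signSum, Fin.sum_univ_succ, Fin.consEquiv]
  rw [← Equiv.sum_comp (Fin.consEquiv fun _ : Fin (n + 1) => ZMod 2)]
  simp only [Fintype.sum_prod_type]
  rw [hu, Finset.sum_pair (by decide), ← Finset.sum_add_distrib]
  refine Finset.sum_congr rfl fun k _ => ?_
  rw [h, h]
  norm_num [bitSign, add_comm, sub_eq_add_neg]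

theorem sum_signSum_moments (n : ℕ) :
    ∑ _k : Node n, (1 : ℝ) = 2 ^ n ∧ ∑ k : Node n, signSum k = 0 ∧
      ∑ k : Node n, signSum k ^ 2 = n * 2 ^ n ∧ ∑ k : Node n, signSum k ^ 3 = 0 ∧
      ∑ k : Node n, signSum k ^ 4 = (3 * n ^ 2 - 2 * n) * 2 ^ n := by
  induction n with
  | zero => simp [signSum]
  | succ n ih =>
    obtain ⟨h0, h1, h2, h3, h4⟩ := ih
    refine ⟨?_, ?_, ?_, ?_, ?_⟩
    · simp
    · rw [sum_signSum_succ n fun s => s]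
      have : ∀ s : ℝ, s + 1 + (s - 1) = 2 * s := fun s => by ring
      simp only [this, ← Finset.mul_sum, h1, mul_zero]
    · rw [sum_signSum_succ n fun s => s ^ 2]
      have : ∀ s : ℝ, (s + 1) ^ 2 + (s - 1) ^ 2 = 2 * s ^ 2 + 2 * 1 := fun s => by ring
      simp only [this, Finset.sum_add_distrib, ← Finset.mul_sum, h0, h2]
      push_cast
      ring
    · rw [sum_signSum_succ n fun s => s ^ 3]
      have : ∀ s : ℝ, (s + 1) ^ 3 + (s - 1) ^ 3 = 2 * s ^ 3 + 6 * s := fun s => by ring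
      simp only [this, Finset.sum_add_distrib, ← Finset.mul_sum, h1, h3, mul_zero, add_zero]
    · rw [sum_signSum_succ n fun s => s ^ 4]
      have : ∀ s : ℝ, (s + 1) ^ 4 + (s - 1) ^ 4 = 2 * s ^ 4 + (12 * s ^ 2 + 2 * 1) :=
        fun s => by ring
      simp only [this, Finset.sum_add_distrib, ← Finset.mul_sum, h0, h2, h4]
      push_cast
      ring

theorem bitSign_le_one (a : ZMod 2) : bitSign a ≤ 1 := by
  rw [bitSign]
  split_ifs <;> norm_num

theorem signSum_le_of_ne_zero {n : ℕ} {k : Node n} (hk : k ≠ 0) : signSum k ≤ n - 2 := by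
  obtain ⟨i, hi⟩ := Function.ne_iff.1 hk
  have h1 : bitSign (k i) = -1 := if_neg hi
  have h2 : ∑ j ∈ Finset.univ.erase i, bitSign (k j) ≤ ∑ j ∈ Finset.univ.erase i, 1 :=
    Finset.sum_le_sum fun j _ => bitSign_le_one (k j)
  have hn : 1 ≤ n := Nat.one_le_of_lt i.pos
  rw [Finset.sum_const, Finset.card_erase_of_mem (Finset.mem_univ i), Finset.card_univ,
    Fintype.card_fin, nsmul_eq_mul, mul_one, Nat.cast_sub hn] at h2
  rw [signSum, ← Finset.add_sum_erase _ _ (Finset.mem_univ i), h1]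
  push_cast at h2
  linarith

theorem two_div_le_one_sub_signSum {n : ℕ} (hn : 1 ≤ n) {k : Node n} (hk : k ≠ 0) :
    2 / n ≤ 1 - signSum k / n := by
  have h0 : (0 : ℝ) < n := by exact_mod_cast hn
  have h := signSum_le_of_ne_zero hk
  rw [div_le_iff₀ h0, sub_mul, div_mul_cancel₀ _ h0.ne']
  linarith

/-! ### The secular equation. -/

/-- The contribution of the non-trivial characters to the diagonal of the Green function at
energy `1 - δ`. -/
def greenTail (n : ℕ) (δ : ℝ) : ℝ :=
  ∑ k ∈ Finset.univ.erase (0 : Node n), 1 / (2 ^ n * (1 - δ - signSum k / n))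

theorem green_self_eq {n : ℕ} (hn : 1 ≤ n) (δ : ℝ) (w : Node n) :
    green (1 - δ) w w = -(1 / (2 ^ n * δ)) + greenTail n δ := by
  have h0 : (n : ℝ) ≠ 0 := by exact_mod_cast (by omega : n ≠ 0)
  rw [green_self, ← Finset.add_sum_erase _ _ (Finset.mem_univ (0 : Node n)), signSum_zero,
    div_self h0, greenTail]
  congr 1
  rw [show 1 - δ - 1 = -δ by ring, mul_neg, div_neg]

theorem sum_cubic_signSum {n : ℕ} (hn : 1 ≤ n) :
    ∑ k : Node n, (1 + signSum k / n + (signSum k / n) ^ 2 + (signSum k / n) ^ 3) =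
      (2 : ℝ) ^ n * (1 + 1 / n) := by
  have h0 : (n : ℝ) ≠ 0 := by exact_mod_cast (by omega : n ≠ 0)
  obtain ⟨m0, m1, m2, m3, -⟩ := sum_signSum_moments n
  simp only [Finset.sum_add_distrib, div_pow, ← Finset.sum_div, m0, m1, m2, m3]
  field_simp
  ring

/-- Cutting the geometric series of 1 / (1 - c) after the cubic term leaves c ^ 4 / (1 - c) ≥ 0. The
loss `4 / 2 ^ n` is the omitted mode `k = 0`, where c = 1. -/
theorem greenTail_lower {n : ℕ} (hn : 1 ≤ n) {δ : ℝ} (hδ : 0 ≤ δ) (hδ' : δ ≤ 1 / n) :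
    1 + 1 / n - 4 / 2 ^ n ≤ greenTail n δ := by
  have h0 : (0 : ℝ) < n := by exact_mod_cast hn
  have h1 : ∀ k ∈ Finset.univ.erase (0 : Node n),
      1 / 2 ^ n * (1 + signSum k / n + (signSum k / n) ^ 2 + (signSum k / n) ^ 3) ≤
        1 / (2 ^ n * (1 - δ - signSum k / n)) := by
    intro k hk
    have h2 := two_div_le_one_sub_signSum hn (Finset.ne_of_mem_erase hk)
    have h3 : (2 : ℝ) / n = 1 / n + 1 / n := by ring
    have h4 : (0 : ℝ) < 1 / n := by positivity
    set c := signSum k / n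
    have hc : 0 < 1 - c := by linarith
    have h5 : 1 / (1 - c) ≤ 1 / (1 - δ - c) :=
      one_div_le_one_div_of_le (by linarith) (by linarith)
    have h6 : 1 + c + c ^ 2 + c ^ 3 ≤ 1 / (1 - c) := by
      rw [le_div_iff₀ hc]
      nlinarith [sq_nonneg (c ^ 2)]
    calc 1 / 2 ^ n * (1 + c + c ^ 2 + c ^ 3) ≤ 1 / 2 ^ n * (1 / (1 - δ - c)) :=
          mul_le_mul_of_nonneg_left (h6.trans h5) (by positivity)
      _ = 1 / (2 ^ n * (1 - δ - c)) := by rw [div_mul_div_comm, one_mul]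
  have h2 := Finset.sum_le_sum h1
  rw [← Finset.mul_sum] at h2
  have h3 := sum_cubic_signSum hn
  rw [← Finset.add_sum_erase _ _ (Finset.mem_univ (0 : Node n)), signSum_zero,
    div_self h0.ne'] at h3
  have h4 : ∑ k ∈ Finset.univ.erase (0 : Node n),
      (1 + signSum k / n + (signSum k / n) ^ 2 + (signSum k / n) ^ 3) =
      (2 : ℝ) ^ n * (1 + 1 / n) - 4 := by linarith
  rw [h4] at h2
  refine le_trans (le_of_eq ?_) h2
  field_simp

/-- By the gap, the series remainder is at most (n / 2) c ^ 4, and the fourth moment makes this less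
than 3 / (2 n) on average. Together with 1 / n from the second moment this gives `5 / (2 * n)`; the
factor `1 + n * δ` pays for replacing 1 - δ by 1. -/
theorem greenTail_upper {n : ℕ} (hn : 1 ≤ n) {δ : ℝ} (hδ : 0 ≤ δ) (hδ' : δ ≤ 1 / n) :
    greenTail n δ ≤ (1 + n * δ) * (1 + 5 / (2 * n)) := by
  have h0 : (0 : ℝ) < n := by exact_mod_cast hn
  have hnδ : n * δ ≤ 1 := by rwa [le_div_iff₀' h0] at hδ'
  set P : Node n → ℝ := fun k => (1 + signSum k / n + (signSum k / n) ^ 2 + (signSum k / n) ^ 3) +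
    n / 2 * (signSum k / n) ^ 4 with hP
  have h1 : ∀ k ∈ Finset.univ.erase (0 : Node n),
      1 / (2 ^ n * (1 - δ - signSum k / n)) ≤ (1 + n * δ) / 2 ^ n * P k := by
    intro k hk
    have h2 := two_div_le_one_sub_signSum hn (Finset.ne_of_mem_erase hk)
    have h3 : (2 : ℝ) / n = 1 / n + 1 / n := by ring
    have h4 : (0 : ℝ) < 1 / n := by positivity
    simp only [hP]
    set c := signSum k / n
    have hc : 0 < 1 - c := by linarith
    have h5 : 1 / (1 - δ - c) ≤ (1 + n * δ) * (1 / (1 - c)) := by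
      rw [mul_one_div, div_le_div_iff₀ (by linarith) hc]
      have h6 : 2 ≤ n * (1 - c) := by rwa [div_le_iff₀' h0] at h2
      nlinarith [mul_nonneg hδ (by linarith : 0 ≤ n * (1 - c) - 1 - n * δ)]
    have h7 : 1 / (1 - c) ≤ 1 + c + c ^ 2 + c ^ 3 + n / 2 * c ^ 4 := by
      have h8 : 1 / (1 - c) = 1 + c + c ^ 2 + c ^ 3 + 1 / (1 - c) * c ^ 4 := by
        field_simp
        ring
      have h9 : 1 / (1 - c) ≤ n / 2 := by
        rw [div_le_div_iff₀ hc two_pos]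
        rwa [div_le_iff₀' h0, ← one_mul (2 : ℝ)] at h2
      have := mul_le_mul_of_nonneg_right h9 (by positivity : 0 ≤ c ^ 4)
      linarith
    calc 1 / (2 ^ n * (1 - δ - c)) = 1 / 2 ^ n * (1 / (1 - δ - c)) := by
          rw [div_mul_div_comm, one_mul]
      _ ≤ 1 / 2 ^ n * ((1 + n * δ) * (1 + c + c ^ 2 + c ^ 3 + n / 2 * c ^ 4)) :=
          mul_le_mul_of_nonneg_left
            (h5.trans (mul_le_mul_of_nonneg_left h7 (by positivity))) (by positivity)
      _ = _ := by ring
  have h2 : ∑ k ∈ Finset.univ.erase (0 : Node n), P k ≤ ∑ k, P k := by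
    rw [← Finset.add_sum_erase _ P (Finset.mem_univ (0 : Node n))]
    have : 0 ≤ P 0 := by
      simp only [hP, signSum_zero]
      positivity
    linarith
  have h3 : ∑ k, P k = 2 ^ n * (1 + 1 / n) + n / 2 * ((3 * n ^ 2 - 2 * n) * 2 ^ n / n ^ 4) := by
    simp only [hP]
    rw [Finset.sum_add_distrib, sum_cubic_signSum hn, ← Finset.mul_sum]
    simp only [div_pow, ← Finset.sum_div]
    rw [(sum_signSum_moments n).2.2.2.2]
  have h4 : ∑ k, P k ≤ 2 ^ n * (1 + 5 / (2 * n)) := by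
    rw [h3]
    have h5 : 2 ^ n * (1 + 5 / (2 * n)) -
        (2 ^ n * (1 + 1 / n) + n / 2 * ((3 * n ^ 2 - 2 * n) * 2 ^ n / n ^ 4)) =
        (2 : ℝ) ^ n / n ^ 2 := by
      field_simp
      ring
    have h6 : (0 : ℝ) < 2 ^ n / n ^ 2 := by positivity
    linarith
  calc greenTail n δ ≤ ∑ k ∈ Finset.univ.erase (0 : Node n), (1 + n * δ) / 2 ^ n * P k :=
        Finset.sum_le_sum h1
    _ = (1 + n * δ) / 2 ^ n * ∑ k ∈ Finset.univ.erase (0 : Node n), P k := by rw [Finset.mul_sum]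
    _ ≤ (1 + n * δ) / 2 ^ n * (2 ^ n * (1 + 5 / (2 * n))) :=
        mul_le_mul_of_nonneg_left (h2.trans h4) (by positivity)
    _ = _ := by field_simp

/-- Intermediate values on [0, 1 / N]: the function is 0 at the left end, and at the right end it
equals the tail, which is at least 1. The gap excludes poles. -/
theorem exists_secular_root {n : ℕ} (hn : 1 ≤ n) (hN : (4 : ℝ) * n ≤ 2 ^ n) :
    ∃ δ : ℝ, 0 < δ ∧ δ ≤ 1 / 2 ^ n ∧ 2 ^ n * δ * greenTail n δ = 1 := by
  have h0 : (0 : ℝ) < n := by exact_mod_cast hn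
  have hNn : (1 : ℝ) / 2 ^ n ≤ 1 / n := one_div_le_one_div_of_le h0 (by linarith)
  have hc : ContinuousOn (fun δ => 2 ^ n * δ * greenTail n δ) (Set.Icc 0 (1 / 2 ^ n)) := by
    refine (continuousOn_const.mul continuousOn_id).mul ?_
    unfold greenTail
    refine continuousOn_finsetSum _ fun k hk => ?_
    refine continuousOn_const.div (by fun_prop) fun δ hδ => ?_
    have h2 := two_div_le_one_sub_signSum hn (Finset.ne_of_mem_erase hk)
    have h3 : (2 : ℝ) / n = 1 / n + 1 / n := by ring
    have h4 : (0 : ℝ) < 1 / n := by positivity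
    have h5 := hδ.2
    have h6 : 0 < 1 - δ - signSum k / n := by linarith
    positivity
  have h1 : (1 : ℝ) ≤ 2 ^ n * (1 / 2 ^ n) * greenTail n (1 / 2 ^ n) := by
    rw [mul_one_div_cancel (by positivity), one_mul]
    refine le_trans ?_ (greenTail_lower hn (by positivity) hNn)
    have : (4 : ℝ) / 2 ^ n ≤ 1 / n := by
      rw [div_le_div_iff₀ (by positivity) h0]
      linarith
    linarith
  obtain ⟨δ, hδ, h⟩ := intermediate_value_Icc (by positivity) hc
    (show (1 : ℝ) ∈ Set.Icc _ _ from ⟨by simp, h1⟩)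
  refine ⟨δ, lt_of_le_of_ne hδ.1 ?_, hδ.2, h⟩
  rintro rfl
  simp at h

theorem sum_sq_green_tail_le {n : ℕ} (hn : 1 ≤ n) {δ : ℝ} (hδ' : δ ≤ 1 / n) :
    ∑ k ∈ Finset.univ.erase (0 : Node n), (1 / (2 ^ n * (1 - δ - signSum k / n))) ^ 2 ≤
      n / 2 ^ n * greenTail n δ := by
  have h0 : (0 : ℝ) < n := by exact_mod_cast hn
  rw [greenTail, Finset.mul_sum]
  refine Finset.sum_le_sum fun k hk => ?_
  have h2 := two_div_le_one_sub_signSum hn (Finset.ne_of_mem_erase hk)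
  have h3 : (2 : ℝ) / n = 1 / n + 1 / n := by ring
  have h5 : 1 / n ≤ 1 - δ - signSum k / n := by linarith
  have h6 : 0 < 1 - δ - signSum k / n := lt_of_lt_of_le (by positivity) h5
  rw [sq]
  refine mul_le_mul_of_nonneg_right ?_ (by positivity)
  rw [div_le_div_iff₀ (by positivity) (by positivity), one_mul]
  rw [div_le_iff₀' h0] at h5
  nlinarith [pow_pos (two_pos : (0 : ℝ) < 2) n]

/-! ### Comparing the walk with the exact rotation. -/

/-- Reverse triangle inequality for the component of the state at `w`. -/
theorem abs_sqrt_nodeProb_sub_le {n : ℕ} (ψ φ : State n) (w : Node n) :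
    |√(nodeProb ψ w) - √(nodeProb φ w)| ≤ √(∑ b, outcomeProb (ψ - φ) b) := by
  have h : ∀ χ : State n,
      √(nodeProb χ w) = ‖(WithLp.toLp 2 fun d => χ (d, w) : EuclideanSpace ℂ (Fin n))‖ := by
    intro χ
    rw [EuclideanSpace.norm_eq]
    rfl
  rw [h, h]
  refine (abs_norm_sub_norm_le _ _).trans ?_
  rw [← WithLp.toLp_sub]
  refine (h (ψ - φ)).symm.le.trans (Real.sqrt_le_sqrt ?_)
  rw [nodeProb, Fintype.sum_prod_type_right]
  exact Finset.single_le_sum (f := fun x => ∑ d, outcomeProb (ψ - φ) (d, x))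
    (fun x _ => Finset.sum_nonneg fun d _ => by rw [outcomeProb]; positivity) (Finset.mem_univ w)

theorem sum_outcomeProb_lift {n : ℕ} (hn : 1 ≤ n) (g : Node n → ℝ) :
    ∑ b, outcomeProb (lift g) b = ∑ x, g x ^ 2 := by
  have h0 : (n : ℝ) ≠ 0 := by exact_mod_cast (by omega : n ≠ 0)
  rw [Fintype.sum_prod_type_right]
  refine Finset.sum_congr rfl fun x _ => ?_
  simp only [outcomeProb, lift, norm_mul, mul_pow, norm_coinState_sq, Complex.norm_real,
    Real.norm_eq_abs, sq_abs, Finset.sum_const, Finset.card_univ, Fintype.card_fin, nsmul_eq_mul]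
  field_simp

theorem one_sub_sub_ne_zero {n : ℕ} (hn : 1 ≤ n) {δ : ℝ} (hδ : 0 < δ) (hδ' : δ ≤ 1 / n)
    (k : Node n) : 1 - δ - signSum k / n ≠ 0 := by
  have h0 : (0 : ℝ) < n := by exact_mod_cast hn
  by_cases hk : k = 0
  · rw [hk, signSum_zero, div_self h0.ne']
    linarith
  · have h2 := two_div_le_one_sub_signSum hn hk
    have h3 : (2 : ℝ) / n = 1 / n + 1 / n := by ring
    have h4 : (0 : ℝ) < 1 / n := by positivity
    linarith

/-- The walk is a rotation by the angle `θ` up to an exponentially small error. -/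
theorem abs_sqrt_nodeProb_walk_sub_le {n : ℕ} (hn : 1 ≤ n) {f : Node n → Bool} {w : Node n}
    (hf : ∀ x, f x = true ↔ x = w) {δ θ : ℝ} (hδ : 0 < δ) (hδ' : δ ≤ 1 / n)
    (hroot : 2 ^ n * δ * greenTail n δ = 1) (hθ : Real.cos θ = 1 - δ) (hs : 0 < Real.sin θ)
    (h1 : 1 ≤ greenTail n δ) (t : ℕ) :
    |√(nodeProb (walk f ^ t *ᵥ initialState n) w) -
      (|Real.sin (t * θ) / (Real.sin θ * (greenTail n δ * √((2 : ℝ) ^ n)))|)| ≤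
        √((n : ℝ) / 2 ^ n) := by
  have h0 : (n : ℝ) ≠ 0 := by exact_mod_cast (by omega : n ≠ 0)
  set h := greenTail n δ with hh
  set g : Node n → ℝ := green (1 - δ) w with hgdef
  set s : ℝ := √((2 : ℝ) ^ n) with hsdef
  have hs0 : 0 < s := Real.sqrt_pos.2 (by positivity)
  have hs2 : s ^ 2 = 2 ^ n := Real.sq_sqrt (by positivity)
  have hδ0 := hδ.ne'
  have hinv : h = 1 / (2 ^ n * δ) := by
    field_simp
    linarith
  have hne := one_sub_sub_ne_zero hn hδ hδ'
  have hgw : g w = 0 := by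
    rw [hgdef, green_self_eq hn, ← hh, hinv]
    ring
  have hy : ∀ x, x ≠ w → ∑ d, g (x + Pi.single d 1) = n * (Real.cos θ * g x) := by
    intro x hx
    rw [hgdef, sum_green_neighbours hn hne, if_neg hx, hθ, sub_zero]
  have hrot := walk_pow_mulVec_lift hn hf hgw hy t
  -- The constant mode of `g` is `-h`, so this scaling matches it to the amplitude `1 / s` of the
  -- node superposition.
  set φ : State n := ((-(1 / (h * s)) : ℝ) : ℂ) • lift g with hφ
  have hφt : ∀ d, (walk f ^ t *ᵥ φ) (d, w) =
      ((Real.sin (t * θ) / (Real.sin θ * (h * s)) : ℝ) : ℂ) * coinState n d := by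
    intro d
    have e := congrFun hrot (d, w)
    simp only [Pi.sub_apply, Pi.smul_apply, shift_mulVec_apply, smul_eq_mul] at e
    have e1 : lift g (move (d, w)) = -coinState n d := by
      simp only [lift, move]
      rw [hgdef, green_neighbour hn hne hgw]
      simp
    have e2 : lift g (d, w) = 0 := by simp [lift, hgw]
    rw [e1, e2, mul_zero, sub_zero] at e
    have e3 : ((Real.sin θ : ℝ) : ℂ) ≠ 0 := by exact_mod_cast hs.ne'
    have e4 : (walk f ^ t *ᵥ lift g) (d, w) =
        -(((Real.sin (t * θ) : ℝ) : ℂ) * coinState n d) / ((Real.sin θ : ℝ) : ℂ) := by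
      rw [eq_div_iff e3, mul_comm, e]
      ring
    rw [hφ, Matrix.mulVec_smul, Pi.smul_apply, e4, smul_eq_mul]
    have e5 : (h : ℂ) ≠ 0 := by exact_mod_cast (by linarith : h ≠ 0)
    have e6 : (s : ℂ) ≠ 0 := by exact_mod_cast hs0.ne'
    push_cast at e3 ⊢
    field_simp
  have hp : √(nodeProb (walk f ^ t *ᵥ φ) w) =
      |Real.sin (t * θ) / (Real.sin θ * (h * s))| := by
    simp only [nodeProb, outcomeProb, hφt, norm_mul, mul_pow, norm_coinState_sq,
      Complex.norm_real, Real.norm_eq_abs, sq_abs, Finset.sum_const, Finset.card_univ,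
      Fintype.card_fin, nsmul_eq_mul]
    rw [← Real.sqrt_sq_eq_abs]
    congr 1
    field_simp
  rw [← hp]
  refine (abs_sqrt_nodeProb_sub_le _ _ w).trans (Real.sqrt_le_sqrt ?_)
  -- By unitarity the error does not grow with `t`; only the initial distance has to be bounded.
  rw [← Matrix.mulVec_sub, sum_outcomeProb_mulVec (walk_pow_mem_unitaryGroup hn f t)]
  have hdiff : initialState n - φ = lift fun x => (g x - 1 / (2 ^ n * (1 - δ - 1))) / (h * s) := by
    funext b
    have e1 : 1 / ((2 : ℝ) ^ n * (1 - δ - 1)) = -h := by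
      rw [hinv, show 1 - δ - 1 = -δ by ring, mul_neg, div_neg]
    simp only [Pi.sub_apply, hφ, Pi.smul_apply, lift, initialState, nodeState, e1, smul_eq_mul]
    rw [← hsdef]
    have e5 : (h : ℂ) ≠ 0 := by exact_mod_cast (by linarith : h ≠ 0)
    have e6 : (s : ℂ) ≠ 0 := by exact_mod_cast hs0.ne'
    push_cast
    field_simp
    ring
  rw [hdiff, sum_outcomeProb_lift hn]
  simp only [div_pow _ (h * s)]
  rw [← Finset.sum_div, hgdef, sum_sq_green_sub_mean hn]
  have hle := sum_sq_green_tail_le hn hδ'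
  rw [← hh] at hle
  have hN : (0 : ℝ) < 2 ^ n := by positivity
  rw [div_le_iff₀ (by positivity)]
  calc (2 : ℝ) ^ n * _ ≤ 2 ^ n * (n / 2 ^ n * h) := mul_le_mul_of_nonneg_left hle hN.le
    _ = n * h := by field_simp
    _ ≤ n * h * h := le_mul_of_one_le_right (by positivity) h1
    _ = n / 2 ^ n * (h * s) ^ 2 := by rw [mul_pow, hs2]; field_simp

/-! ### The rotation angle and the final time. -/

theorem sq_arccos_le {δ : ℝ} (h0 : 0 ≤ δ) (h1 : δ ≤ 2) : Real.arccos (1 - δ) ^ 2 ≤ 5 * δ := by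
  have hθ0 := Real.arccos_nonneg (1 - δ)
  have h := Real.cos_le_one_sub_mul_cos_sq
    (abs_le.2 ⟨by linarith [Real.pi_pos], Real.arccos_le_pi (1 - δ)⟩)
  rw [Real.cos_arccos (by linarith) (by linarith)] at h
  have h2 : 2 / Real.pi ^ 2 * Real.arccos (1 - δ) ^ 2 ≤ δ := by linarith
  have hπ : Real.pi ^ 2 ≤ 10 := by nlinarith [Real.pi_lt_d2, Real.pi_pos]
  rw [div_mul_eq_mul_div, div_le_iff₀ (by positivity)] at h2
  nlinarith

theorem finalTime_eq {n : ℕ} (hn : 1 ≤ n) : finalTime n = Real.pi / 2 * √((2 : ℝ) ^ n / 2) := by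
  obtain ⟨m, rfl⟩ : ∃ m, n = m + 1 := ⟨n - 1, by omega⟩
  rw [finalTime, Nat.add_sub_cancel, pow_succ, mul_div_cancel_right₀ _ two_ne_zero]

theorem sqrt_two_mul_le_arccos {δ : ℝ} (h0 : 0 ≤ δ) (h1 : δ ≤ 2) :
    √(2 * δ) ≤ Real.arccos (1 - δ) := by
  have h := Real.one_sub_sq_div_two_le_cos (x := Real.arccos (1 - δ))
  rw [Real.cos_arccos (by linarith) (by linarith)] at h
  exact Real.sqrt_le_iff.2 ⟨Real.arccos_nonneg _, by linarith⟩

/-- The sine of the angle is √(δ (2 - δ)) ≤ √(2 δ), and the cubic lower bound for sine does the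
rest. -/
theorem arccos_sub_sqrt_two_mul_le {δ : ℝ} (h0 : 0 < δ) :
    Real.arccos (1 - δ) - √(2 * δ) ≤ Real.arccos (1 - δ) ^ 3 / 6 := by
  have h := Real.sin_gt_sub_cube (Real.arccos_pos.2 (by linarith : 1 - δ < 1))
  rw [Real.sin_arccos] at h
  have h2 : √(1 - (1 - δ) ^ 2) ≤ √(2 * δ) := Real.sqrt_le_sqrt (by nlinarith)
  linarith

theorem one_sub_le_sqrt_one_div {h m : ℝ} (h1 : 1 ≤ h) (h2 : h ≤ 1 + m) :
    1 - m ≤ √(1 / h) := by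
  have e1 : 1 - m ≤ 1 / h := by
    rw [le_div_iff₀ (by linarith)]
    nlinarith
  refine e1.trans (Real.le_sqrt_of_sq_le ?_)
  have e2 : 1 / h ≤ 1 := by rw [div_le_one (by linarith)]; exact h1
  have e3 : 0 < 1 / h := by positivity
  nlinarith

/-- The rotation angle satisfies `θ ≈ √(2 δ)`, so after `finalTime n ± 1` steps the total angle
is close to `π / 2`. -/
theorem abs_mul_arccos_sub_pi_div_two_le {n : ℕ} (hn : 1 ≤ n) (hN : (10000 : ℝ) * n ^ 3 ≤ 2 ^ n)
    {δ h : ℝ} (hδ : 0 < δ) (hδN : δ ≤ 1 / 2 ^ n) (hroot : 2 ^ n * δ * h = 1) (h1 : 1 ≤ h)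
    (h2 : h ≤ 1 + 3 / n) {t : ℝ} (ht : |t - finalTime n| ≤ 1) :
    |t * Real.arccos (1 - δ) - Real.pi / 2| ≤ 10 / n := by
  have hn1 : (1 : ℝ) ≤ n := by exact_mod_cast hn
  have hN0 : (0 : ℝ) < 2 ^ n := by positivity
  have hπ := Real.pi_pos
  have hπ' := Real.pi_lt_d2
  have hδ1 : δ ≤ 1 / (10000 * n ^ 3) := hδN.trans (one_div_le_one_div_of_le (by positivity) hN)
  have hn3 : (n : ℝ) ^ 2 ≤ n ^ 3 := pow_le_pow_right₀ hn1 (by norm_num)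
  have hδ2 : δ ≤ 1 / (10000 * n ^ 2) :=
    hδ1.trans (one_div_le_one_div_of_le (by positivity) (by linarith))
  have hδ3 : δ ≤ 1 := hδN.trans (by
    rw [div_le_one hN0]
    exact one_le_pow₀ one_le_two)
  have hθ5 := sq_arccos_le hδ.le (by linarith)
  have hθpos : 0 < Real.arccos (1 - δ) := Real.arccos_pos.2 (by linarith)
  set θ := Real.arccos (1 - δ)
  set β := √(2 * δ) with hβ
  have hβθ : β ≤ θ := sqrt_two_mul_le_arccos hδ.le (by linarith)
  have hθβ : θ - β ≤ θ ^ 3 / 6 := arccos_sub_sqrt_two_mul_le hδ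
  have hθn : θ ≤ 1 / n := by
    refine le_of_sq_le_sq ?_ (by positivity)
    refine hθ5.trans ((mul_le_mul_of_nonneg_left hδ2 (by norm_num)).trans ?_)
    rw [div_pow, mul_one_div, div_le_div_iff₀ (by positivity) (by positivity)]
    linarith [sq_nonneg (n : ℝ)]
  have hθn2 : θ ^ 2 ≤ 1 / n := by
    have : (1 : ℝ) / n ≤ 1 := by rw [div_le_one (by positivity)]; exact hn1
    exact (pow_le_of_le_one hθpos.le (hθn.trans this) two_ne_zero).trans hθn
  set T := finalTime n with hT
  have hT0 : 0 ≤ T := by rw [hT, finalTime_eq hn]; positivity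
  have hT2 : T ^ 2 = Real.pi ^ 2 / 8 * 2 ^ n := by
    rw [hT, finalTime_eq hn, mul_pow, Real.sq_sqrt (by positivity)]
    ring
  have hNδ : 2 ^ n * δ ≤ 1 := by rwa [le_div_iff₀' hN0] at hδN
  have hTθ : T * θ ≤ 3 := by
    refine le_of_sq_le_sq ?_ (by norm_num)
    rw [mul_pow, hT2]
    have hπ2 : Real.pi ^ 2 ≤ 10 := by nlinarith only [hπ, hπ']
    calc Real.pi ^ 2 / 8 * 2 ^ n * θ ^ 2 ≤ Real.pi ^ 2 / 8 * 2 ^ n * (5 * δ) := by gcongr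
      _ = Real.pi ^ 2 / 8 * 5 * (2 ^ n * δ) := by ring
      _ ≤ 10 / 8 * 5 * 1 := by gcongr
      _ ≤ 3 ^ 2 := by norm_num
  -- The secular equation gives δ = 1 / (N h), so N cancels.
  have hTβ : T * β = Real.pi / 2 * √(1 / h) := by
    rw [hT, finalTime_eq hn, hβ, mul_assoc, ← Real.sqrt_mul (by positivity)]
    congr 2
    rw [eq_div_iff (by linarith)]
    linarith
  have hsq1 : √(1 / h) ≤ 1 :=
    Real.sqrt_le_one.2 (by rw [div_le_one (by linarith)]; exact h1)
  have hsq2 : 1 - 3 / n ≤ √(1 / h) := one_sub_le_sqrt_one_div h1 h2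
  have hn0 : (0 : ℝ) < 1 / n := by positivity
  have e3 : (3 : ℝ) / n = 3 * (1 / n) := by ring
  have e10 : (10 : ℝ) / n = 10 * (1 / n) := by ring
  rw [e3] at hsq2
  have hA : |T * β - Real.pi / 2| ≤ 6 * (1 / n) := by
    rw [hTβ, abs_le]
    constructor <;> nlinarith only [hsq1, hsq2, hπ, hπ', hn0]
  have hB : |T * (θ - β)| ≤ 1 / n := by
    rw [abs_of_nonneg (mul_nonneg hT0 (by linarith))]
    calc T * (θ - β) ≤ T * (θ ^ 3 / 6) := mul_le_mul_of_nonneg_left hθβ hT0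
      _ = T * θ * θ ^ 2 / 6 := by ring
      _ ≤ 3 * (1 / n) / 6 := by gcongr
      _ ≤ 1 / n := by linarith
  have hC : |(t - T) * θ| ≤ 1 / n := by
    rw [abs_mul, abs_of_pos hθpos]
    exact (mul_le_of_le_one_left hθpos.le ht).trans hθn
  -- Three errors: `h` is not 1, `θ` is not `√(2 * δ)`, and `t` is not `T`.
  have hsplit : t * θ - Real.pi / 2 = (T * β - Real.pi / 2) + T * (θ - β) + (t - T) * θ := by ring
  rw [hsplit, e10]
  refine (abs_add_three _ _ _).trans ?_
  linarith

/-! ### The success probability of one run. -/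

theorem nodeProb_nonneg {n : ℕ} (ψ : State n) (w : Node n) : 0 ≤ nodeProb ψ w :=
  Finset.sum_nonneg fun d _ => by rw [outcomeProb]; positivity

theorem sq_bounds_of_abs_sub_le {r a ε : ℝ} (hr : 0 ≤ r) (ha : 0 ≤ a) (ha1 : a ≤ 1)
    (hε1 : ε ≤ 1) (h : |r - a| ≤ ε) : a ^ 2 - 2 * ε ≤ r ^ 2 ∧ r ^ 2 ≤ a ^ 2 + 3 * ε := by
  obtain ⟨hl, hu⟩ := abs_le.1 h
  have hε : 0 ≤ ε := (abs_nonneg _).trans h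
  constructor
  · by_cases e : ε ≤ a
    · have : (a - ε) ^ 2 ≤ r ^ 2 := pow_le_pow_left₀ (by linarith) (by linarith) 2
      nlinarith
    · nlinarith
  · have : r ^ 2 ≤ (a + ε) ^ 2 := pow_le_pow_left₀ hr (by linarith) 2
    nlinarith

/-- Here `m` stands for 1 / n. The excess of `h` over 1 outweighs the loss from `δ`, and the margin
`m / 5` below 1 / 2 is reserved for the approximation error. -/
theorem peak_bounds {S δ h m : ℝ} (hm0 : 0 < m) (hm1 : m ≤ 1) (hδ : 0 < δ) (hδm : δ ≤ m / 10000)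
    (hlow : 1 + 99 / 100 * m ≤ h) (hup : h ≤ 1 + 3 * m) (hS1 : S ≤ 1)
    (hS : 1 - 100 * m ≤ S) :
    1 / 2 - 103 / 2 * m ≤ S / ((2 - δ) * h) ∧ S / ((2 - δ) * h) ≤ 1 / 2 - m / 5 := by
  have hden : 0 < (2 - δ) * h := mul_pos (by linarith) (by linarith)
  have hlow' : 2 + 19 / 10 * m ≤ (2 - δ) * h := by nlinarith
  have hup' : (2 - δ) * h ≤ 2 + 6 * m := by nlinarith
  rw [le_div_iff₀ hden, div_le_iff₀ hden]
  constructor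
  · by_cases e : 0 ≤ 1 / 2 - 103 / 2 * m
    · nlinarith
    · nlinarith
  · nlinarith

theorem nodeProb_walk_bounds {n : ℕ} (hn : 1 ≤ n) (hN : (10000 : ℝ) * n ^ 3 ≤ 2 ^ n)
    {f : Node n → Bool} {w : Node n} (hf : ∀ x, f x = true ↔ x = w) {t : ℕ}
    (ht : |(t : ℝ) - finalTime n| ≤ 1) :
    0 ≤ 1 / 2 - nodeProb (walk f ^ t *ᵥ initialState n) w ∧
      1 / 2 - nodeProb (walk f ^ t *ᵥ initialState n) w ≤ 60 / n := by
  have hn1 : (1 : ℝ) ≤ n := by exact_mod_cast hn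
  have hN0 : (0 : ℝ) < 2 ^ n := by positivity
  have hn2 : (n : ℝ) ≤ n ^ 2 := by nlinarith
  have hn3 : (n : ℝ) ^ 2 ≤ n ^ 3 := pow_le_pow_right₀ hn1 (by norm_num)
  obtain ⟨δ, hδ, hδN, hroot⟩ := exists_secular_root hn (by linarith)
  set m : ℝ := 1 / n with hm
  have hm0 : 0 < m := by positivity
  have hm1 : m ≤ 1 := by rw [hm, div_le_one (by positivity)]; exact hn1
  have hNm : 1 / (2 : ℝ) ^ n ≤ m / 10000 := by
    rw [hm, div_div]
    exact one_div_le_one_div_of_le (by positivity) (by linarith)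
  have hnN : (n : ℝ) / 2 ^ n ≤ (m / 100) ^ 2 := by
    rw [hm, div_div, div_pow, one_pow, div_le_div_iff₀ hN0 (by positivity)]
    nlinarith
  have hδ' : δ ≤ 1 / n := by rw [← hm]; linarith
  have hlow := greenTail_lower hn hδ.le hδ'
  have hup := greenTail_upper hn hδ.le hδ'
  have hε : √((n : ℝ) / 2 ^ n) ≤ m / 100 := Real.sqrt_le_iff.2 ⟨by positivity, hnN⟩
  have hnδ : n * δ ≤ m / 100 := by
    have : n * δ ≤ n * (1 / 2 ^ n) := mul_le_mul_of_nonneg_left hδN (by positivity)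
    rw [mul_one_div] at this
    nlinarith
  set h := greenTail n δ with hh
  have hlow' : 1 + 99 / 100 * m ≤ h := by
    have : (4 : ℝ) / 2 ^ n = 4 * (1 / 2 ^ n) := by ring
    linarith
  have hup' : h ≤ 1 + 3 * m := by
    have e : (5 : ℝ) / (2 * n) = 5 / 2 * m := by rw [hm]; field_simp
    rw [e] at hup
    nlinarith
  have h1 : 1 ≤ h := by linarith
  have hcos : Real.cos (Real.arccos (1 - δ)) = 1 - δ := Real.cos_arccos (by linarith) (by linarith)
  have hangle := abs_mul_arccos_sub_pi_div_two_le hn hN hδ hδN hroot h1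
    (by rw [hm] at hup'; linarith [show (3 : ℝ) / n = 3 * (1 / n) by ring]) ht
  have hs2 := Real.sin_sq_add_cos_sq (Real.arccos (1 - δ))
  have hs : 0 < Real.sin (Real.arccos (1 - δ)) := by
    rw [Real.sin_arccos]
    exact Real.sqrt_pos.2 (by nlinarith)
  have hmain := abs_sqrt_nodeProb_walk_sub_le hn hf hδ hδ' hroot hcos hs h1 t
  rw [← hh] at hmain
  rw [hcos] at hs2
  set θ := Real.arccos (1 - δ)
  set p := nodeProb (walk f ^ t *ᵥ initialState n) w
  have hp2 : √p ^ 2 = p := Real.sq_sqrt (nodeProb_nonneg _ _)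
  set a := |Real.sin (t * θ) / (Real.sin θ * (h * √((2 : ℝ) ^ n)))| with ha
  have ha0 : 0 ≤ a := abs_nonneg _
  -- Since sin² θ = δ (2 - δ), the secular equation removes N from the denominator.
  have ha2 : a ^ 2 = Real.sin (t * θ) ^ 2 / ((2 - δ) * h) := by
    rw [ha, sq_abs, div_pow, mul_pow, mul_pow, Real.sq_sqrt hN0.le]
    congr 1
    have e : Real.sin θ ^ 2 = δ * (2 - δ) := by linarith
    rw [e]
    calc δ * (2 - δ) * (h ^ 2 * 2 ^ n) = (2 ^ n * δ * h) * ((2 - δ) * h) := by ring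
      _ = _ := by rw [hroot, one_mul]
  have hsin : 1 - 100 * m ≤ Real.sin (t * θ) ^ 2 := by
    have e1 : |Real.cos (t * θ)| ≤ 10 * m := by
      rw [← Real.sin_pi_div_two_sub]
      refine Real.abs_sin_le_abs.trans ?_
      rw [abs_sub_comm, hm]
      linarith [show (10 : ℝ) / n = 10 * (1 / n) by ring]
    have e2 := Real.sin_sq_add_cos_sq (t * θ)
    have e3 := pow_le_pow_left₀ (abs_nonneg _) e1 2
    rw [sq_abs] at e3
    nlinarith only [e2, e3, hm0, hm1]
  obtain ⟨hlo, hhi⟩ := peak_bounds hm0 hm1 hδ (hδN.trans hNm) hlow' hup'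
    (Real.sin_sq_le_one _) hsin
  rw [← ha2] at hlo hhi
  have ha1 : a ≤ 1 := (sq_le_one_iff₀ ha0).1 (by linarith)
  obtain ⟨h3, h4⟩ := sq_bounds_of_abs_sub_le (Real.sqrt_nonneg p) ha0 ha1 (by linarith) hmain
  rw [hp2] at h3 h4
  have e2 : (60 : ℝ) / n = 60 * m := by rw [hm]; ring
  rw [e2]
  -- The error is at most `m / 100`: three times it stays below `m / 5`, and twice it fits between
  -- 103 / 2 and 60.
  constructor <;> linarith

/-! ### Repetition and oracle calls. -/

theorem searchOutput_eq_some_iff {n r : ℕ} {f : Node n → Bool} {w : Node n}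
    (hf : ∀ x, f x = true ↔ x = w) (o : Fin r → Label n) :
    searchOutput f o = some w ↔ ¬ ∀ i, (o i).2 ≠ w := by
  rw [searchOutput]
  constructor
  · intro h hall
    obtain ⟨i, hi⟩ := List.mem_ofFn.1 (List.mem_of_find?_eq_some h)
    exact hall i hi
  · intro h
    push Not at h
    obtain ⟨i, hi⟩ := h
    rcases hx : (List.ofFn fun i => (o i).2).find? f with _ | x
    · exact absurd ((hf _).2 hi) (List.find?_eq_none.1 hx _ (List.mem_ofFn.2 ⟨i, rfl⟩))
    · rw [(hf x).1 (List.find?_some hx)]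

/-- Failure means that all `r` independent outcomes miss `w`, and the sum over such tuples factors.
-/
theorem repeatedProb_eq {n : ℕ} {f : Node n → Bool} {w : Node n}
    (hf : ∀ x, f x = true ↔ x = w) (A : List (Instr n)) (r : ℕ)
    (hA : ∑ b, outcomeProb (run f A (initialState n)) b = 1) :
    repeatedProb f A r w = 1 - (1 - nodeProb (run f A (initialState n)) w) ^ r := by
  set ψ := run f A (initialState n) with hψ
  have hmiss : ∑ b : Label n with b.2 ≠ w, outcomeProb ψ b = 1 - nodeProb ψ w := by
    have h1 := Finset.sum_filter_add_sum_filter_not Finset.univ (fun b : Label n => b.2 = w)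
      (outcomeProb ψ)
    have h2 : ∑ b : Label n with b.2 = w, outcomeProb ψ b = nodeProb ψ w := by
      rw [Finset.sum_filter, Fintype.sum_prod_type]
      simp [nodeProb]
    rw [hA, h2] at h1
    linarith
  have htotal : ∑ o : Fin r → Label n, ∏ i, outcomeProb ψ (o i) = 1 := by
    have h := Finset.prod_univ_sum (fun _ : Fin r => (Finset.univ : Finset (Label n)))
      (fun _ b => outcomeProb ψ b)
    rw [Fintype.piFinset_univ] at h
    rw [← h]
    simp [hA]
  have hfail : ∑ o : Fin r → Label n with ∀ i, (o i).2 ≠ w, ∏ i, outcomeProb ψ (o i) =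
      (1 - nodeProb ψ w) ^ r := by
    have h := Finset.prod_univ_sum
      (fun _ : Fin r => (Finset.univ.filter fun b : Label n => b.2 ≠ w))
      (fun _ b => outcomeProb ψ b)
    have hset : (Fintype.piFinset fun _ : Fin r => Finset.univ.filter fun b : Label n => b.2 ≠ w) =
        Finset.univ.filter fun o : Fin r → Label n => ∀ i, (o i).2 ≠ w := by
      ext o
      simp
    rw [hset] at h
    rw [← h, hmiss]
    simp
  have hsplit := Finset.sum_filter_add_sum_filter_not Finset.univ
    (fun o : Fin r → Label n => ∀ i, (o i).2 ≠ w) (fun o => ∏ i, outcomeProb ψ (o i))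
  rw [repeatedProb, ← hψ]
  simp only [searchOutput_eq_some_iff hf]
  rw [hfail, htotal] at hsplit
  linarith

theorem oracleCalls_walkSearch (n t : ℕ) : oracleCalls (walkSearch n t) = t := by
  induction t with
  | zero => rfl
  | succ t ih =>
    simp only [oracleCalls, walkSearch] at ih ⊢
    simp only [List.replicate_succ, List.flatten_cons, List.map_append, List.sum_append, ih]
    simp [Instr.cost, add_comm]

theorem le_three_mul_sqrt {n : ℕ} (hn : 1 ≤ n) {t : ℝ} (ht : |t - finalTime n| ≤ 1) :
    t ≤ 3 * √((2 : ℝ) ^ n) := by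
  have h1 : (1 : ℝ) ≤ √((2 : ℝ) ^ n) := Real.one_le_sqrt.2 (one_le_pow₀ one_le_two)
  have h2 : √((2 : ℝ) ^ n / 2) ≤ √((2 : ℝ) ^ n) := by
    apply Real.sqrt_le_sqrt
    have : (0 : ℝ) < 2 ^ n := by positivity
    linarith
  have h3 : finalTime n ≤ 2 * √((2 : ℝ) ^ n) := by
    rw [finalTime_eq hn]
    have := Real.pi_lt_d2
    exact mul_le_mul (by linarith) h2 (Real.sqrt_nonneg _) (by norm_num)
  have := (abs_le.1 ht).2
  linarith

/-- This threshold makes √(n / N) at most 1 / (100 n), well within the margin below 1 / 2. -/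
theorem exists_forall_mul_cube_le_two_pow :
    ∃ k : ℕ, ∀ n, k ≤ n → (10000 : ℝ) * n ^ 3 ≤ 2 ^ n := by
  have h := (tendsto_pow_const_div_const_pow_of_one_lt 3 (one_lt_two : (1 : ℝ) < 2)).eventually_lt_const
    (show (0 : ℝ) < 1 / 10000 by norm_num)
  obtain ⟨k, hk⟩ := Filter.eventually_atTop.1 h
  refine ⟨k, fun n hn => ?_⟩
  have := hk n hn
  rw [div_lt_div_iff₀ (by positivity) (by norm_num)] at this
  linarith

theorem one_sub_le_repeatedProb {n : ℕ} (hn : 240 ≤ n) (hN : (10000 : ℝ) * n ^ 3 ≤ 2 ^ n)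
    {f : Node n → Bool} {w : Node n} (hf : ∀ x, f x = true ↔ x = w) {t : ℕ}
    (ht : |(t : ℝ) - finalTime n| ≤ 1) (r : ℕ) :
    1 - (3 / 4 : ℝ) ^ r ≤ repeatedProb f (walkSearch n t) r w := by
  have hn1 : 1 ≤ n := by omega
  have hsum : ∑ b, outcomeProb (run f (walkSearch n t) (initialState n)) b = 1 := by
    rw [run_walkSearch, sum_outcomeProb_mulVec (walk_pow_mem_unitaryGroup hn1 f t),
      sum_outcomeProb_initialState hn1]
  obtain ⟨h1, h2⟩ := nodeProb_walk_bounds hn1 hN hf ht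
  rw [repeatedProb_eq hf _ r hsum, run_walkSearch]
  -- The threshold 240 makes each run succeed with probability at least 1 / 4.
  have h3 : (60 : ℝ) / n ≤ 1 / 4 := by
    have : (240 : ℝ) ≤ n := by exact_mod_cast hn
    rw [div_le_div_iff₀ (by linarith) (by norm_num)]
    linarith
  exact sub_le_sub_left (pow_le_pow_left₀ (by linarith) (by linarith) r) 1

end HypercubeSearch

end

open HypercubeSearch in
theorem mainTheorem1 :
    -- one run: success probability `1/2 - O(1/n)` with `O(√N)` oracle calls, `N = 2 ^ n`
    (∃ C K : ℝ, ∃ k : ℕ, 0 < C ∧ 0 < K ∧ 1 ≤ k ∧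
      ∀ n : ℕ, k ≤ n → ∀ (f : Node n → Bool) (w : Node n), (∀ x, f x = true ↔ x = w) →
        ∀ t : ℕ, |(t : ℝ) - finalTime n| ≤ 1 →
          0 ≤ 1 / 2 - nodeProb (walk f ^ t *ᵥ initialState n) w ∧
          1 / 2 - nodeProb (walk f ^ t *ᵥ initialState n) w ≤ C / n ∧
          run f (walkSearch n t) (initialState n) = walk f ^ t *ᵥ initialState n ∧
          (oracleCalls (walkSearch n t) : ℝ) ≤ K * √((2 : ℝ) ^ n)) ∧
    -- search with arbitrarily small error, by a constant number of repetitions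
    (∀ ε : ℝ, 0 < ε → ∃ r : ℕ, ∃ K : ℝ, ∃ k : ℕ, 0 < K ∧ 1 ≤ k ∧
      ∀ n : ℕ, k ≤ n → ∀ (f : Node n → Bool) (w : Node n), (∀ x, f x = true ↔ x = w) →
        ∀ t : ℕ, |(t : ℝ) - finalTime n| ≤ 1 →
          1 - ε ≤ repeatedProb f (walkSearch n t) r w ∧
          (repeatedCalls (walkSearch n t) r : ℝ) ≤ K * √((2 : ℝ) ^ n)) := by
  obtain ⟨k, hk⟩ := exists_forall_mul_cube_le_two_pow
  constructor
  · refine ⟨60, 3, k + 1, by norm_num, by norm_num, by omega, fun n hn f w hf t ht => ?_⟩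
    have hn1 : 1 ≤ n := by omega
    obtain ⟨h1, h2⟩ := nodeProb_walk_bounds hn1 (hk n (by omega)) hf ht
    refine ⟨h1, h2, run_walkSearch f t _, ?_⟩
    rw [oracleCalls_walkSearch]
    exact le_three_mul_sqrt hn1 ht
  · intro ε hε
    obtain ⟨r, hr⟩ := exists_pow_lt_of_lt_one hε (by norm_num : (3 / 4 : ℝ) < 1)
    -- Each repetition costs `t + 1` calls, at most `4 * √N`; the extra 1 keeps the constant
    -- positive if `r = 0`.
    refine ⟨r, 4 * r + 1, k + 240, by positivity, by omega, fun n hn f w hf t ht => ⟨?_, ?_⟩⟩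
    · have := one_sub_le_repeatedProb (by omega : 240 ≤ n) (hk n (by omega)) hf ht r
      linarith
    · have h1 : (1 : ℝ) ≤ √((2 : ℝ) ^ n) := Real.one_le_sqrt.2 (one_le_pow₀ one_le_two)
      have h2 := le_three_mul_sqrt (by omega : 1 ≤ n) ht
      have h3 : (r : ℝ) * (t + 1) ≤ r * (4 * √((2 : ℝ) ^ n)) :=
        mul_le_mul_of_nonneg_left (by linarith) (Nat.cast_nonneg r)
      rw [repeatedCalls, oracleCalls_walkSearch]
      push_cast
      linarith
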